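/- Let $K=\mathbf F_q$ be a finite field of characteristic $p$, let $X$ be a variety over $K$ (a separated scheme of finite type) and $f:X\to\mathbf A^1$ a morphism over $K$; the pair $(X,f)$ represents a class $[X,f]$ in the coarse Grothendieck ring with exponentials of $K$-varieties. Let $\chi:K\to\mathbf C^*$ be a character of the additive group of $K$. Let $S^n(X)=X^n/\mathfrak S_n$ be the symmetric powers (the quotients being taken in locally ringed spaces; for quasi-projective $X$ these are the usual quotient varieties), let $f^{(n)}:S^n(X)\to\mathbf A^1$, $[x_1,\dots,x_n]\mapsto f(x_1)+\dots+f(x_n)$, and $$\zeta_\chi((X,f),t)=\sum_{n\ge 0}\ \sum_{x\in S^n(X)(K)}\chi(f^{(n)}(x))\,t^n .$$ Fix $t\in\mathbf C$ with $\sum_{n}\#S^n(X)(K)\,|t|^n<\infty$ and such that the zeta functions $\zeta$ appearing below do not vanish at $t$. Put $$P^{(f,\chi)}_{n,x}=\frac{\chi(f^{(n)}(x))\,t^n}{\zeta_\chi((X,f),t)}\qquad(n\ge0,\ x\in S^n(X)(K)),$$ and, for a function $g$ of $(n,x)$, $\langle g\rangle=\sum_{n,x}P^{(f,\chi)}_{n,x}\,g(n,x)$.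 For a function $u$ on $K$ and a morphism $g:X\to\mathbf A^1$ write $\langle u(g)\rangle$ for $\langle u(g^{(n)}(x))\rangle$. Consider the following two situations. (a) Let $h:X\to\mathbf A^1$ be a morphism over $K$, $F:X\times\mathbf A^1\to\mathbf A^1$, $F(x,\epsilon)=f(x)+\epsilon h(x)$, let $\epsilon\in K$, $f_\epsilon=F(\cdot,\epsilon)$ and $\chi_\epsilon(a)=\chi(\epsilon a)$. Put $Q=P^{(f_\epsilon,\chi)}$, $\varphi=\chi_\epsilon$, $g=h$. (b) Let $\chi':K\to\mathbf C^*$ be another character and $\psi=\chi^{-1}\chi'$. Put $Q=P^{(f,\chi')}$, $\varphi=\psi$, $g=f$. In both situations, with $P=P^{(f,\chi)}$, the series for $\langle\varphi(g)\rangle$ converges absolutely, $\langle\varphi(g)\rangle\neq0$, and the Kullback–Leibler divergence satisfies $$KL(P\|Q)=\sum_{n,x}P_{n,x}\log\frac{P_{n,x}}{Q_{n,x}}=\log\langle\varphi(g)\rangle-\langle\log\varphi(g)\rangle ,$$ with absolutely convergent series, in the following precise sense. 1. Let $\log\langle\varphi(g)\rangle$ be any logarithm of $\langle\varphi(g)\rangle$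 and $\log\varphi:K\to\mathbf C$ any function with $\exp(\log\varphi(a))=\varphi(a)$ for all $a\in K$. Then $\log\langle\varphi(g)\rangle-\log\varphi(g^{(n)}(x))$ is a logarithm of $P_{n,x}/Q_{n,x}$ whenever $P_{n,x}\ne0$, and the formula holds when these logarithms are used for $\log(P_{n,x}/Q_{n,x})$. 2. If all logarithms are computed with one arbitrary branch $\log$ (a function with $\exp(\log z)=z$ for all $z\neq0$), then there is a function $k:K\to\mathbf Z$ with $\log\frac{\langle\varphi(g)\rangle}{\varphi(a)}=\log\langle\varphi(g)\rangle-\log\varphi(a)+2\pi i\,k(a)$ for all $a\in K$, and $$KL(P\|Q)=\log\langle\varphi(g)\rangle-\langle\log\varphi(g)\rangle+2\pi i\,\langle k(g)\rangle .$$ 3. If $p\neq2$ and $|\arg\langle\varphi(g)\rangle|<\pi/p$, the formula holds, without correction term, for the principal branch of the logarithm. -/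

import Mathlib

open CategoryTheory CategoryTheory.Limits AlgebraicGeometry

universe u

noncomputable section

namespace MotivicKL

/-! ### The affine line and functions on a `K`-scheme -/

section Geometry

variable (K : Type u) [Field K]

/-- The affine line over `K`. -/
abbrev A1 : Scheme.{u} := 𝔸(PUnit.{u + 1}; Spec (CommRingCat.of K))

variable {K}

/-- The regular function (pullback of the coordinate) defined by a morphism to the affine line. -/
def regFun {X : Scheme.{u}} (f : X ⟶ A1 K) : Γ(X, ⊤) :=
  f.appTop (AffineSpace.coord (Spec (CommRingCat.of K)) PUnit.unit)

/-- The morphism over `Spec K` to the affine line with a given coordinate function; `p` is the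
structure morphism of the source. -/
def ofRegFun {X : Scheme.{u}} (p : X ⟶ Spec (CommRingCat.of K)) (s : Γ(X, ⊤)) : X ⟶ A1 K :=
  AffineSpace.homOfVector p (fun _ => s)

/-- The `K`-point `ε` of the affine line. -/
def pointA1 (ε : K) : Spec (CommRingCat.of K) ⟶ A1 K :=
  ofRegFun (𝟙 _) ((Scheme.ΓSpecIso (CommRingCat.of K)).inv ε)

variable {X : Scheme.{u}} [X.Over (Spec (CommRingCat.of K))]

/-- The family `F : X ×_K 𝔸¹ ⟶ 𝔸¹`, `F (x, ε) = f x + ε * h x`. -/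
def family (f h : X ⟶ A1 K) :
    pullback (X ↘ Spec (CommRingCat.of K)) (A1 K ↘ Spec (CommRingCat.of K)) ⟶ A1 K :=
  ofRegFun (pullback.fst _ _ ≫ X ↘ Spec (CommRingCat.of K))
    (regFun (pullback.fst _ _ ≫ f) + regFun (pullback.snd _ _) * regFun (pullback.fst _ _ ≫ h))

/-- The deformed function `f_ε = F (·, ε)`: the restriction of the family `F` along
`x ↦ (x, ε)`. -/
def deform (f h : X ⟶ A1 K) (ε : K) : X ⟶ A1 K :=
  pullback.lift (𝟙 X) (X ↘ Spec (CommRingCat.of K) ≫ pointA1 ε)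
    (by simp [pointA1, ofRegFun]) ≫ family f h

/-! ### Symmetric powers -/

variable (K X) in
/-- The `n`-fold fibre power of `X` over `Spec K`. -/
abbrev fibrePow (n : ℕ) : Scheme.{u} :=
  widePullback (Spec (CommRingCat.of K)) (fun _ : Fin n => X)
    (fun _ => X ↘ Spec (CommRingCat.of K))

variable (K X) in
/-- The structure morphism of the fibre power. -/
abbrev fibrePowOver (n : ℕ) : fibrePow K X n ⟶ Spec (CommRingCat.of K) :=
  WidePullback.base (fun _ : Fin n => X ↘ Spec (CommRingCat.of K))

variable (K X) in
/-- The `i`-th projection of the fibre power. -/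
abbrev proj (n : ℕ) (i : Fin n) : fibrePow K X n ⟶ X :=
  WidePullback.π (fun _ : Fin n => X ↘ Spec (CommRingCat.of K)) i

variable (K X) in
/-- The action of a permutation of the factors on the fibre power. -/
def permMap (n : ℕ) (σ : Equiv.Perm (Fin n)) : fibrePow K X n ⟶ fibrePow K X n :=
  WidePullback.lift (fibrePowOver K X n) (fun i => proj K X n (σ i))
    (fun i => WidePullback.π_arrow _ (σ i))

variable (K X) in
/-- The symmetric power `S^n(X)`: the quotient of the fibre power by the symmetric group, formed
in locally ringed spaces. (When `X` is quasi-projective this is the usual quotient variety; schemes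
are a full subcategory of locally ringed spaces.) -/
abbrev symPow (n : ℕ) : LocallyRingedSpace.{u} :=
  wideCoequalizer (fun σ : Equiv.Perm (Fin n) => (permMap K X n σ).toLRSHom)

/-- The morphism `(x₁, …, xₙ) ↦ f x₁ + ⋯ + f xₙ` on the fibre power. -/
def sumMap (f : X ⟶ A1 K) (n : ℕ) : fibrePow K X n ⟶ A1 K :=
  ofRegFun (fibrePowOver K X n) (∑ i, regFun (proj K X n i ≫ f))

lemma permMap_over (n : ℕ) (σ : Equiv.Perm (Fin n)) :
    permMap K X n σ ≫ fibrePowOver K X n = fibrePowOver K X n :=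
  WidePullback.lift_base _ _ _ _

lemma permMap_proj (n : ℕ) (σ : Equiv.Perm (Fin n)) (i : Fin n) :
    permMap K X n σ ≫ proj K X n i = proj K X n (σ i) :=
  WidePullback.lift_π _ _ _ _ _

lemma regFun_comp {Y Z : Scheme.{u}} (g : Y ⟶ Z) (f : Z ⟶ A1 K) :
    g.appTop (regFun f) = regFun (g ≫ f) := by
  unfold regFun
  rw [Scheme.Hom.comp_appTop, CommRingCat.comp_apply]

lemma permMap_sumMap (f : X ⟶ A1 K) (n : ℕ) (σ : Equiv.Perm (Fin n)) :
    permMap K X n σ ≫ sumMap f n = sumMap f n := by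
  unfold sumMap ofRegFun
  rw [AffineSpace.comp_homOfVector, permMap_over]
  congr 1
  funext _
  simp only [Function.comp_apply, map_sum, regFun_comp, ← Category.assoc, permMap_proj]
  exact Equiv.sum_comp σ (fun i => regFun (proj K X n i ≫ f))

variable (K X) in
/-- The structure morphism of the symmetric power. -/
def symPowOver (n : ℕ) :
    symPow K X n ⟶ (Spec (CommRingCat.of K)).toLocallyRingedSpace :=
  wideCoequalizer.desc
    (fibrePowOver K X n).toLRSHom
    (fun σ τ => by simp only [← Scheme.Hom.comp_toLRSHom, permMap_over])

/-- The morphism `f^{(n)} : S^n(X) ⟶ 𝔸¹`, `[x₁, …, xₙ] ↦ f x₁ + ⋯ + f xₙ`. -/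
def symMap (f : X ⟶ A1 K) (n : ℕ) : symPow K X n ⟶ (A1 K).toLocallyRingedSpace :=
  wideCoequalizer.desc
    (sumMap f n).toLRSHom
    (fun σ τ => by simp only [← Scheme.Hom.comp_toLRSHom, permMap_sumMap])

/-! ### Rational points, exponential sums and zeta functions -/

/-- The `K`-rational points of a locally ringed space with structure morphism `p` to `Spec K`. -/
def RatPoint {Y : LocallyRingedSpace.{u}}
    (p : Y ⟶ (Spec (CommRingCat.of K)).toLocallyRingedSpace) : Type u :=
  { x : (Spec (CommRingCat.of K)).toLocallyRingedSpace ⟶ Y // x ≫ p = 𝟙 _ }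

/-- The value in `K` of a function `g : Y ⟶ 𝔸¹` at a rational point. -/
def value {Y : LocallyRingedSpace.{u}}
    {p : Y ⟶ (Spec (CommRingCat.of K)).toLocallyRingedSpace}
    (g : Y ⟶ (A1 K).toLocallyRingedSpace) (x : RatPoint p) : K :=
  (Scheme.ΓSpecIso (CommRingCat.of K)).hom
    (regFun (Scheme.Hom.mk (x.1 ≫ g) : Spec (CommRingCat.of K) ⟶ A1 K))

/-- The exponential sum `μ_χ(Y, g) = ∑_{x ∈ Y(K)} χ(g(x))`. -/
def expSum (χ : AddChar K ℂ) {Y : LocallyRingedSpace.{u}}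
    (p : Y ⟶ (Spec (CommRingCat.of K)).toLocallyRingedSpace)
    (g : Y ⟶ (A1 K).toLocallyRingedSpace) : ℂ :=
  ∑' x : RatPoint p, χ (value g x)

/-- The zeta function `ζ_χ((X, f), t) = ∑_n μ_χ(S^n(X), f^{(n)}) t^n`. -/
def zeta (χ : AddChar K ℂ) (f : X ⟶ A1 K) (t : ℂ) : ℂ :=
  ∑' n : ℕ, expSum χ (symPowOver K X n) (symMap f n) * t ^ n

variable (K X) in
/-- The configuration space: pairs `(n, x)` with `x ∈ S^n(X)(K)`. -/
abbrev Config : Type u := Σ n : ℕ, RatPoint (symPowOver K X n)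

/-- The function `(n, x) ↦ f^{(n)}(x)` on configurations. -/
def configValue (f : X ⟶ A1 K) (i : Config K X) : K := value (symMap f i.1) i.2

/-- The normalised weights `P_{n,x} = χ(f^{(n)}(x)) t^n / ζ_χ((X, f), t)`. -/
def weight (χ : AddChar K ℂ) (f : X ⟶ A1 K) (t : ℂ) (i : Config K X) : ℂ :=
  χ (configValue f i) * t ^ i.1 / zeta χ f t

end Geometry

/-! ### Expectations and relative entropy of complex weights -/

/-- The expectation `⟨g⟩ = ∑_i P_i g_i`. -/
def expect {ι : Type*} (P g : ι → ℂ) : ℂ := ∑' i, P i * g i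

/-- A branch of the logarithm: any (not necessarily continuous) choice of logarithms of the
nonzero complex numbers. -/
def IsLogBranch (L : ℂ → ℂ) : Prop := ∀ z, z ≠ 0 → Complex.exp (L z) = z

/-- `ℓ i` is a logarithm of `P i / Q i` for every `i`, and the Kullback-Leibler series
`∑_i P_i log (P_i / Q_i)` formed with these logarithms converges absolutely, with sum `v`. -/
def HasKL {ι : Type*} (P Q ℓ : ι → ℂ) (v : ℂ) : Prop :=
  (∀ i, P i / Q i ≠ 0 → Complex.exp (ℓ i) = P i / Q i) ∧ HasSum (fun i => P i * ℓ i) v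

end MotivicKL

end

/-! In both situations the new weights are a twist of the old ones: Q = P φ(g) / R with R = ⟨φ(g)⟩.
Here R is the quotient of the two zeta values, hence nonzero (`expect_weight_twist`,
`weight_twist`). So P/Q = R/φ(g) wherever P ≠ 0, and since P has total mass 1, averaging log R - log
φ(g) gives the formula. Convergence is automatic, because functions on the finite field K are
bounded. What remains is the choice of logarithms. Two logarithms of R/φ(a) differ by a multiple of
2πi, which gives the correction k. For odd p, the values of φ are p-th roots of unity, whose
arguments stay π/p away from ±π, so no correction occurs if |arg R| < π/p. Geometry enters only
through the identity f_ε^(n) = f^(n) + ε h^(n) at rational points (`configValue_deform`), which is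
checked on X^n. -/

namespace MotivicKL

/-! ### Values of functions at rational points of symmetric powers -/

section Geometry

variable {K : Type u} [Field K]

/-- Pullback of global functions along a morphism of locally ringed spaces. -/
noncomputable def pullbackFun {Y Z : LocallyRingedSpace.{u}} (g : Y ⟶ Z) :
    Z.presheaf.obj (Opposite.op ⊤) →+* Y.presheaf.obj (Opposite.op ⊤) :=
  (LocallyRingedSpace.Γ.map g.op).hom

lemma pullbackFun_comp {W Y Z : LocallyRingedSpace.{u}} (g : W ⟶ Y) (h : Y ⟶ Z)
    (s : Z.presheaf.obj (Opposite.op ⊤)) :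
    pullbackFun (g ≫ h) s = pullbackFun g (pullbackFun h s) := by
  unfold pullbackFun
  rw [op_comp, Functor.map_comp]
  rfl

lemma pullbackFun_id {Y : LocallyRingedSpace.{u}}
    (s : Y.presheaf.obj (Opposite.op ⊤)) : pullbackFun (𝟙 Y) s = s := by
  unfold pullbackFun
  rw [op_id, CategoryTheory.Functor.map_id]
  rfl

lemma pullbackFun_toLRSHom {Y Z : Scheme.{u}} (g : Y ⟶ Z) (s : Γ(Z, ⊤)) :
    pullbackFun g.toLRSHom s = g.appTop s := rfl

/-- Global functions are determined by their pullback along an epimorphism, because taking global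
sections is a left adjoint. -/
lemma pullbackFun_injective {Y Z : LocallyRingedSpace.{u}} (g : Y ⟶ Z) [Epi g] :
    Function.Injective (pullbackFun g) := by
  have : LocallyRingedSpace.Γ.{u}.rightOp.IsLeftAdjoint :=
    ΓSpec.locallyRingedSpaceAdjunction.isLeftAdjoint
  have h1 : Epi (LocallyRingedSpace.Γ.rightOp.map g) := inferInstance
  have h2 : Mono (LocallyRingedSpace.Γ.map g.op) :=
    (unop_mono_iff (LocallyRingedSpace.Γ.rightOp.map g)).2 h1
  exact (ConcreteCategory.mono_iff_injective_of_preservesPullback _).1 h2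

lemma regFun_ofRegFun {X : Scheme.{u}} (p : X ⟶ Spec (CommRingCat.of K)) (s : Γ(X, ⊤)) :
    regFun (ofRegFun p s) = s :=
  AffineSpace.homOfVector_appTop_coord _ _ _

/-- The constant function on `Spec K`. -/
noncomputable def constFun (a : K) : Γ(Spec (CommRingCat.of K), ⊤) :=
  (Scheme.ΓSpecIso (CommRingCat.of K)).inv a

/-- Evaluation at a point is a composite of ring homomorphisms, so identities between global
functions pass to values. -/
lemma value_eq {Y : LocallyRingedSpace.{u}}
    {p : Y ⟶ (Spec (CommRingCat.of K)).toLocallyRingedSpace}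
    (g : Y ⟶ (A1 K).toLocallyRingedSpace) (x : RatPoint p) :
    value g x = (Scheme.ΓSpecIso (CommRingCat.of K)).hom
      (pullbackFun x.1 (pullbackFun g
        (AffineSpace.coord (Spec (CommRingCat.of K)) PUnit.unit))) :=
  congrArg (Scheme.ΓSpecIso (CommRingCat.of K)).hom (pullbackFun_comp x.1 g _)

variable {X : Scheme.{u}} [X.Over (Spec (CommRingCat.of K))]

lemma regFun_deform (f h : X ⟶ A1 K) (ε : K) :
    regFun (deform f h ε) =
      regFun f + (X ↘ Spec (CommRingCat.of K)).appTop (constFun ε) * regFun h := by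
  unfold deform
  rw [← regFun_comp, family, regFun_ofRegFun, map_add, map_mul]
  simp only [regFun_comp, ← Category.assoc, pullback.lift_fst, pullback.lift_snd]
  simp only [Category.id_comp]
  rw [← regFun_comp, pointA1, regFun_ofRegFun]
  rfl

lemma pullbackFun_symMap (f : X ⟶ A1 K) (n : ℕ) :
    pullbackFun (wideCoequalizer.π (fun σ : Equiv.Perm (Fin n) => (permMap K X n σ).toLRSHom))
      (pullbackFun (symMap f n) (AffineSpace.coord (Spec (CommRingCat.of K)) PUnit.unit)) =
      ∑ i, (proj K X n i).appTop (regFun f) := by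
  rw [← pullbackFun_comp, symMap, wideCoequalizer.π_desc, pullbackFun_toLRSHom]
  simp only [regFun_comp]
  exact regFun_ofRegFun _ _

lemma pullbackFun_symPowOver (n : ℕ) (s : Γ(Spec (CommRingCat.of K), ⊤)) :
    pullbackFun (wideCoequalizer.π (fun σ : Equiv.Perm (Fin n) => (permMap K X n σ).toLRSHom))
      (pullbackFun (symPowOver K X n) s) = (fibrePowOver K X n).appTop s := by
  rw [← pullbackFun_comp, symPowOver, wideCoequalizer.π_desc, pullbackFun_toLRSHom]

/-- The quotient map from X^n is an epimorphism, so it suffices to compare pullbacks to X^n, where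
both sides are explicit sums over the factors. -/
lemma pullbackFun_symMap_deform (f h : X ⟶ A1 K) (ε : K) (n : ℕ) :
    pullbackFun (symMap (deform f h ε) n)
        (AffineSpace.coord (Spec (CommRingCat.of K)) PUnit.unit) =
      pullbackFun (symMap f n) (AffineSpace.coord (Spec (CommRingCat.of K)) PUnit.unit) +
      pullbackFun (symPowOver K X n) (constFun ε) *
        pullbackFun (symMap h n) (AffineSpace.coord (Spec (CommRingCat.of K)) PUnit.unit) := by
  apply pullbackFun_injective
    (wideCoequalizer.π (fun σ : Equiv.Perm (Fin n) => (permMap K X n σ).toLRSHom))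
  -- All projections lie over the base, so the constant ε is the same in every summand and factors
  -- out of the sum.
  have hproj (i : Fin n) : (proj K X n i).appTop ((X ↘ Spec (CommRingCat.of K)).appTop
      (constFun ε)) = (fibrePowOver K X n).appTop (constFun ε) := by
    rw [← CommRingCat.comp_apply, ← Scheme.Hom.comp_appTop, WidePullback.π_arrow]
  rw [map_add, map_mul, pullbackFun_symMap, pullbackFun_symMap, pullbackFun_symMap,
    pullbackFun_symPowOver]
  erw [Finset.mul_sum, ← Finset.sum_add_distrib]
  refine Finset.sum_congr rfl fun i _ => ?_
  rw [regFun_deform, map_add, map_mul, hproj]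

lemma configValue_deform (f h : X ⟶ A1 K) (ε : K) (i : Config K X) :
    configValue (deform f h ε) i = configValue f i + ε * configValue h i := by
  obtain ⟨n, x⟩ := i
  simp only [configValue, value_eq, pullbackFun_symMap_deform, map_add, map_mul]
  -- A rational point is a section of the structure morphism.
  have hx : pullbackFun x.1 (pullbackFun (symPowOver K X n) (constFun ε)) = constFun ε :=
    (pullbackFun_comp _ _ _).symm.trans
      ((congrArg (pullbackFun · (constFun ε)) x.2).trans (pullbackFun_id _))
  have hε : (Scheme.ΓSpecIso (CommRingCat.of K)).hom (constFun ε) = ε := by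
    rw [constFun, ← CommRingCat.comp_apply, Iso.inv_hom_id, CommRingCat.id_apply]
  erw [hx, hε]

end Geometry

/-! ### Zeta functions as sums over configurations -/

section Zeta

variable {K : Type u} [Field K] [Finite K] {X : Scheme.{u}} [X.Over (Spec (CommRingCat.of K))]

lemma summable_character_mul_pow {t : ℂ} (ht : Summable (fun i : Config K X => ‖t‖ ^ i.1))
    (χ : AddChar K ℂ) (u : Config K X → K) :
    Summable (fun i : Config K X => χ (u i) * t ^ i.1) :=
  .of_norm (by simpa using ht)

/-- Characters of a finite group have modulus 1, so `ht` gives absolute convergence and permits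
regrouping by n. -/
lemma zeta_eq_tsum {t : ℂ} (ht : Summable (fun i : Config K X => ‖t‖ ^ i.1))
    (χ : AddChar K ℂ) (f : X ⟶ A1 K) :
    zeta χ f t = ∑' i : Config K X, χ (configValue f i) * t ^ i.1 := by
  rw [(summable_character_mul_pow ht χ (configValue f)).tsum_sigma]
  simp only [zeta, expSum, ← tsum_mul_right]
  rfl

lemma summable_weight {t : ℂ} (ht : Summable (fun i : Config K X => ‖t‖ ^ i.1))
    (χ : AddChar K ℂ) (f : X ⟶ A1 K) : Summable (weight χ f t) :=
  (summable_character_mul_pow ht χ (configValue f)).div_const _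

lemma tsum_weight {t : ℂ} (ht : Summable (fun i : Config K X => ‖t‖ ^ i.1))
    (χ : AddChar K ℂ) (f : X ⟶ A1 K) (hz : zeta χ f t ≠ 0) : ∑' i, weight χ f t i = 1 := by
  unfold weight
  rw [tsum_div_const, ← zeta_eq_tsum ht, div_self hz]

end Zeta

/-! ### Relative entropy of a family of weights and a character twist of it -/

section Entropy

variable {K : Type*} [Field K] [Finite K]

lemma character_ne_zero (φ : AddChar K ℂ) (a : K) : φ a ≠ 0 :=
  norm_ne_zero_iff.1 (by simp)

lemma abs_arg_character_le (hp : ringChar K ≠ 2) (φ : AddChar K ℂ) (a : K) :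
    |(φ a).arg| ≤ Real.pi - Real.pi / ringChar K := by
  have hprime : (ringChar K).Prime := CharP.char_is_prime K _
  have hodd : Odd (ringChar K) := hprime.odd_of_ne_two hp
  have hpos : (0 : ℝ) < ringChar K := by exact_mod_cast hprime.pos
  have hpow : φ a ^ ringChar K = 1 := by
    rw [← AddChar.map_nsmul_eq_pow, nsmul_eq_mul, CharP.cast_eq_zero, zero_mul,
      AddChar.map_zero_eq_one]
  have hexp : Complex.exp ((φ a).arg * Complex.I) = φ a := by
    simpa using Complex.norm_mul_exp_arg_mul_I (φ a)
  rw [← hexp, ← Complex.exp_nat_mul, Complex.exp_eq_one_iff] at hpow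
  obtain ⟨j, hj⟩ := hpow
  have hj' : (ringChar K : ℝ) * (φ a).arg = j * (2 * Real.pi) := by
    have : (ringChar K : ℂ) * (φ a).arg = j * (2 * Real.pi) :=
      mul_right_cancel₀ Complex.I_ne_zero (by linear_combination hj)
    exact_mod_cast this
  have habs : (ringChar K : ℝ) * |(φ a).arg| = (|2 * j| : ℤ) * Real.pi := by
    have := congrArg abs hj'
    rw [abs_mul, abs_mul, abs_mul, Nat.abs_cast, abs_of_pos Real.pi_pos, abs_two] at this
    rw [this]
    push_cast
    rw [abs_mul, abs_two]
    ring
  -- The bound |arg| ≤ π only gives |2j| ≤ p; parity excludes equality, as p is odd.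
  have hle : |2 * j| ≤ ringChar K - 1 := by
    have h1 : ((|2 * j| : ℤ) : ℝ) ≤ (ringChar K : ℝ) := by
      have := mul_le_mul_of_nonneg_left (Complex.abs_arg_le_pi (φ a)) hpos.le
      rw [habs] at this
      exact le_of_mul_le_mul_right this Real.pi_pos
    have h2 : |2 * j| ≤ (ringChar K : ℤ) := by exact_mod_cast h1
    obtain ⟨m, hm⟩ := hodd
    rcases abs_cases (2 * j) with h | h <;> omega
  have hle' : ((|2 * j| : ℤ) : ℝ) ≤ (ringChar K : ℝ) - 1 := by exact_mod_cast hle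
  have : (ringChar K : ℝ) * |(φ a).arg| ≤
      (ringChar K : ℝ) * (Real.pi - Real.pi / ringChar K) := by
    rw [habs, mul_sub, mul_div_cancel₀ _ hpos.ne']
    nlinarith [mul_le_mul_of_nonneg_right hle' Real.pi_pos.le]
  exact le_of_mul_le_mul_left this hpos

variable {ι : Type*} {P Q : ι → ℂ} {φ : AddChar K ℂ} {g : ι → K} {R : ℂ}

lemma summable_mul_comp {K : Type*} [Finite K] (hP : Summable P) (u : K → ℂ) (g : ι → K) :
    Summable (fun i => P i * u (g i)) := by
  obtain ⟨C, hC⟩ := (Set.finite_range fun a => ‖u a‖).bddAbove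
  refine .of_norm_bounded (hP.norm.mul_right C) fun i => ?_
  rw [norm_mul]
  exact mul_le_mul_of_nonneg_left (hC ⟨g i, rfl⟩) (norm_nonneg _)

lemma ratio_eq (hR : R ≠ 0) (hQ : ∀ i, Q i = P i * φ (g i) / R) {i : ι} (hi : P i ≠ 0) :
    P i / Q i = R / φ (g i) := by
  have := character_ne_zero φ (g i)
  rw [hQ]
  field_simp

lemma hasKL_of_log (hP : Summable P) (hP1 : ∑' i, P i = 1) (hR : R ≠ 0)
    (hQ : ∀ i, Q i = P i * φ (g i) / R) {c : ℂ} {lam : K → ℂ} (hc : Complex.exp c = R)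
    (hlam : ∀ a, Complex.exp (lam a) = φ a) :
    HasKL P Q (fun i => c - lam (g i)) (c - expect P (fun i => lam (g i))) := by
  refine ⟨fun i hi => ?_, ?_⟩
  · have hPi : P i ≠ 0 := fun h => hi (by rw [h, zero_div])
    rw [ratio_eq hR hQ hPi, Complex.exp_sub, hc, hlam]
  · have h1 := (hP1 ▸ hP.hasSum).mul_right c
    rw [one_mul] at h1
    exact (h1.sub (summable_mul_comp hP lam g).hasSum).congr_fun fun i => mul_sub _ _ _

lemma hasKL_of_branch (hP : Summable P) (hP1 : ∑' i, P i = 1) (hR : R ≠ 0)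
    (hQ : ∀ i, Q i = P i * φ (g i) / R) {L : ℂ → ℂ} (hL : IsLogBranch L) {k : K → ℤ}
    (hk : ∀ a, L (R / φ a) = L R - L (φ a) + 2 * Real.pi * Complex.I * k a) :
    HasKL P Q (fun i => L (P i / Q i))
      (L R - expect P (fun i => L (φ (g i)))
        + 2 * Real.pi * Complex.I * expect P (fun i => (k (g i) : ℂ))) := by
  refine ⟨fun i hi => hL _ hi, ?_⟩
  have h1 := (hasKL_of_log hP hP1 hR hQ (hL R hR) fun a => hL _ (character_ne_zero φ a)).2
  have h2 := (summable_mul_comp hP (fun a => (k a : ℂ)) g).hasSum.mul_left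
    (2 * Real.pi * Complex.I)
  refine (h1.add h2).congr_fun ?_
  intro i
  by_cases hi : P i = 0
  -- Here P/Q = 0 and the value L 0 is arbitrary, but it is multiplied by P = 0. This occurs for t =
  -- 0, n > 0.
  · simp [hi]
  · simp only [ratio_eq hR hQ hi, hk]
    ring

lemma exists_branch_correction (hR : R ≠ 0) (φ : AddChar K ℂ) {L : ℂ → ℂ} (hL : IsLogBranch L) :
    ∃ k : K → ℤ, ∀ a, L (R / φ a) = L R - L (φ a) + 2 * Real.pi * Complex.I * k a := by
  have h (a : K) : ∃ m : ℤ, L (R / φ a) = L R - L (φ a) + 2 * Real.pi * Complex.I * m := by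
    have hφ := character_ne_zero φ a
    have : Complex.exp (L (R / φ a)) = Complex.exp (L R - L (φ a)) := by
      rw [Complex.exp_sub, hL _ hR, hL _ hφ, hL _ (div_ne_zero hR hφ)]
    obtain ⟨m, hm⟩ := Complex.exp_eq_exp_iff_exists_int.1 this
    exact ⟨m, by rw [hm]; ring⟩
  choose k hk using h
  exact ⟨k, hk⟩

/-- The bounds π/p (strict) and π - π/p on the two arguments add up to π, so their difference stays
in the principal strip. -/
lemma log_div_character (hR : R ≠ 0) (hp : ringChar K ≠ 2)
    (harg : |R.arg| < Real.pi / ringChar K) (φ : AddChar K ℂ) (a : K) :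
    Complex.log (R / φ a) = Complex.log R - Complex.log (φ a) := by
  have hφ := character_ne_zero φ a
  have h1 := abs_le.1 (abs_arg_character_le hp φ a)
  have h2 := abs_lt.1 harg
  rw [← Complex.log_exp (x := Complex.log R - Complex.log (φ a)), Complex.exp_sub,
    Complex.exp_log hR, Complex.exp_log hφ]
  · rw [Complex.sub_im, Complex.log_im, Complex.log_im]
    linarith
  · rw [Complex.sub_im, Complex.log_im, Complex.log_im]
    linarith

/-- The relative entropy of a normalised family of weights `P` and its twist `Q` by a character. -/
theorem relativeEntropy_twist (hP : Summable P) (hP1 : ∑' i, P i = 1) (hR : R ≠ 0)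
    (hQ : ∀ i, Q i = P i * φ (g i) / R) :
    Summable (fun i => P i * φ (g i)) ∧ R ≠ 0 ∧
      (∀ (c : ℂ) (lam : K → ℂ), Complex.exp c = R → (∀ a, Complex.exp (lam a) = φ a) →
        Summable (fun i => P i * lam (g i)) ∧
        HasKL P Q (fun i => c - lam (g i)) (c - expect P (fun i => lam (g i)))) ∧
      (∀ L : ℂ → ℂ, IsLogBranch L → ∃ k : K → ℤ,
        (∀ a, L (R / φ a) = L R - L (φ a) + 2 * Real.pi * Complex.I * k a) ∧
        HasKL P Q (fun i => L (P i / Q i))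
          (L R - expect P (fun i => L (φ (g i)))
            + 2 * Real.pi * Complex.I * expect P (fun i => (k (g i) : ℂ)))) ∧
      (ringChar K ≠ 2 → |R.arg| < Real.pi / ringChar K →
        HasKL P Q (fun i => Complex.log (P i / Q i))
          (Complex.log R - expect P (fun i => Complex.log (φ (g i))))) := by
  refine ⟨summable_mul_comp hP φ g, hR, fun c lam hc hlam =>
    ⟨summable_mul_comp hP lam g, hasKL_of_log hP hP1 hR hQ hc hlam⟩, fun L hL => ?_,
    fun hp harg => ?_⟩
  · obtain ⟨k, hk⟩ := exists_branch_correction hR φ hL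
    exact ⟨k, hk, hasKL_of_branch hP hP1 hR hQ hL hk⟩
  · have h := hasKL_of_branch hP hP1 hR hQ (L := Complex.log) (k := fun _ => 0)
      (fun z hz => Complex.exp_log hz)
      (fun a => by simpa using log_div_character hR hp harg φ a)
    simpa [expect] using h

end Entropy

section Twist

variable {K : Type u} [Field K] {X : Scheme.{u}} [X.Over (Spec (CommRingCat.of K))]
  {t : ℂ} {χ χ' φ : AddChar K ℂ} {f f' h : X ⟶ A1 K}

/-- The hypothesis `htwist` covers both situations: χ' = χ, f' = f_ε, φ = χ_ε in (a), and f' = h =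
f, φ = χ⁻¹χ' in (b). -/
lemma expect_weight_twist [Finite K] (ht : Summable (fun i : Config K X => ‖t‖ ^ i.1))
    (htwist : ∀ i : Config K X,
      χ' (configValue f' i) = χ (configValue f i) * φ (configValue h i)) :
    expect (weight χ f t) (fun i => φ (configValue h i)) = zeta χ' f' t / zeta χ f t := by
  rw [zeta_eq_tsum ht χ' f', ← tsum_div_const]
  refine tsum_congr fun i => ?_
  rw [htwist, weight]
  ring

lemma weight_twist (hz : zeta χ f t ≠ 0)
    (htwist : ∀ i : Config K X,
      χ' (configValue f' i) = χ (configValue f i) * φ (configValue h i)) (i : Config K X) :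
    weight χ' f' t i =
      weight χ f t i * φ (configValue h i) / (zeta χ' f' t / zeta χ f t) := by
  rw [weight, weight, htwist]
  field_simp

end Twist

end MotivicKL

open MotivicKL in
theorem proposition6p1p3
    {K : Type u} [Field K] [Finite K]
    (X : Scheme.{u}) [X.Over (Spec (CommRingCat.of K))]
    [IsSeparated (X ↘ Spec (CommRingCat.of K))]
    [LocallyOfFiniteType (X ↘ Spec (CommRingCat.of K))]
    [QuasiCompact (X ↘ Spec (CommRingCat.of K))]
    (f : X ⟶ A1 K) [f.IsOver (Spec (CommRingCat.of K))]
    (χ : AddChar K ℂ) (t : ℂ)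
    (ht : Summable (fun i : Config K X => ‖t‖ ^ i.1))
    (hz : zeta χ f t ≠ 0) :
    -- variation of the function
    (∀ (h : X ⟶ A1 K) [h.IsOver (Spec (CommRingCat.of K))] (ε : K),
      zeta χ (deform f h ε) t ≠ 0 →
      let P : Config K X → ℂ := weight χ f t
      let Q : Config K X → ℂ := weight χ (deform f h ε) t
      let χε : AddChar K ℂ := χ.mulShift ε
      let R : ℂ := expect P (fun i => χε (configValue h i))
      Summable (fun i => P i * χε (configValue h i)) ∧ R ≠ 0 ∧
      -- for all choices of logarithms of the expectation and of the values of the character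
      (∀ (c : ℂ) (lam : K → ℂ), Complex.exp c = R → (∀ a, Complex.exp (lam a) = χε a) →
        Summable (fun i => P i * lam (configValue h i)) ∧
        HasKL P Q (fun i => c - lam (configValue h i))
          (c - expect P (fun i => lam (configValue h i)))) ∧
      -- for one branch of the logarithm, applied to all numbers involved
      (∀ L : ℂ → ℂ, IsLogBranch L → ∃ k : K → ℤ,
        (∀ a, L (R / χε a) = L R - L (χε a) + 2 * Real.pi * Complex.I * k a) ∧
        HasKL P Q (fun i => L (P i / Q i))
          (L R - expect P (fun i => L (χε (configValue h i)))
            + 2 * Real.pi * Complex.I * expect P (fun i => (k (configValue h i) : ℂ)))) ∧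
      -- for the principal branch
      (ringChar K ≠ 2 → |R.arg| < Real.pi / ringChar K →
        HasKL P Q (fun i => Complex.log (P i / Q i))
          (Complex.log R - expect P (fun i => Complex.log (χε (configValue h i)))))) ∧
    -- variation of the character
    (∀ χ' : AddChar K ℂ, zeta χ' f t ≠ 0 →
      let P : Config K X → ℂ := weight χ f t
      let Q : Config K X → ℂ := weight χ' f t
      let ψ : AddChar K ℂ := χ⁻¹ * χ'
      let R : ℂ := expect P (fun i => ψ (configValue f i))
      Summable (fun i => P i * ψ (configValue f i)) ∧ R ≠ 0 ∧
      (∀ (c : ℂ) (lam : K → ℂ), Complex.exp c = R → (∀ a, Complex.exp (lam a) = ψ a) →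
        Summable (fun i => P i * lam (configValue f i)) ∧
        HasKL P Q (fun i => c - lam (configValue f i))
          (c - expect P (fun i => lam (configValue f i)))) ∧
      (∀ L : ℂ → ℂ, IsLogBranch L → ∃ k : K → ℤ,
        (∀ a, L (R / ψ a) = L R - L (ψ a) + 2 * Real.pi * Complex.I * k a) ∧
        HasKL P Q (fun i => L (P i / Q i))
          (L R - expect P (fun i => L (ψ (configValue f i)))
            + 2 * Real.pi * Complex.I * expect P (fun i => (k (configValue f i) : ℂ)))) ∧
      (ringChar K ≠ 2 → |R.arg| < Real.pi / ringChar K →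
        HasKL P Q (fun i => Complex.log (P i / Q i))
          (Complex.log R - expect P (fun i => Complex.log (ψ (configValue f i)))))) := by
  refine ⟨fun h _ ε hz' => ?_, fun χ' hz' => ?_⟩
  · intro P Q χε R
    have htwist (i : Config K X) : χ (configValue (deform f h ε) i) =
        χ (configValue f i) * χε (configValue h i) := by
      rw [configValue_deform, AddChar.map_add_eq_mul, AddChar.mulShift_apply]
    have hR : R = zeta χ (deform f h ε) t / zeta χ f t := expect_weight_twist ht htwist
    exact relativeEntropy_twist (summable_weight ht χ f) (tsum_weight ht χ f hz)
      (hR ▸ div_ne_zero hz' hz) (fun i => hR ▸ weight_twist hz htwist i)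
  · intro P Q ψ R
    have htwist (i : Config K X) : χ' (configValue f i) =
        χ (configValue f i) * ψ (configValue f i) := by
      rw [AddChar.mul_apply, AddChar.inv_apply',
        mul_inv_cancel_left₀ (character_ne_zero χ _)]
    have hR : R = zeta χ' f t / zeta χ f t := expect_weight_twist ht htwist
    exact relativeEntropy_twist (summable_weight ht χ f) (tsum_weight ht χ f hz)
      (hR ▸ div_ne_zero hz' hz) (fun i => hR ▸ weight_twist hz htwist i)
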